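/- Let $\pi=\pi_1\pi_2\cdots\pi_n$ be a permutation of $[n]=\{1,\dots,n\}$ and put $\pi_0=0$. An index $1\le i\le n-1$ with $\pi_{i-1}<\pi_i>\pi_{i+1}$ is an exterior peak; it is of pattern $132$ if $\pi_{i-1}<\pi_{i+1}$, and of pattern $231$ if $\pi_{i-1}>\pi_{i+1}$. An index $2\le i\le n-1$ with $\pi_{i-1}>\pi_i>\pi_{i+1}$ is a proper double descent. Let $ep_1(\pi)$, $ep_2(\pi)$ and $pdd(\pi)$ be the numbers of exterior peaks of pattern $132$, of exterior peaks of pattern $231$, and of proper double descents of $\pi$, and for $n\ge 0$ let $$P_n(x,y,z,w,u,v)=\sum_{\pi\in\mathfrak S_n}x^{ep_1(\pi)}v^{ep_1(\pi)}u^{ep_2(\pi)}z^{ep_2(\pi)+1}y^{pdd(\pi)}w^{\,n-2(ep_1(\pi)+ep_2(\pi))-pdd(\pi)} .$$ (The exponent of $w$ is always non-negative.) Let ${}_1F_1(a;b;z)=\sum_{k\ge0}\frac{(a)_k}{(b)_k}\frac{z^k}{k!}$, where $(a)_k=a(a+1)\cdots(a+k-1)$, and let $$D_a(z)=2^{a/2}\sqrt{\pi}\,e^{-z^2/4}\left(\frac{1}{\Gamma\left(\frac{1-a}{2}\right)}\,{}_1F_1\left(-\frac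 a2;\frac12;\frac{z^2}2\right)-\frac{\sqrt2\,z}{\Gamma\left(-\frac a2\right)}\,{}_1F_1\left(\frac{1-a}2;\frac32;\frac{z^2}2\right)\right)$$ be the parabolic cylinder function ($a,z\in\mathbb C$, with $1/\Gamma=0$ at the poles of $\Gamma$). **Theorem.** Let $x,y,z,w,u,v\in\mathbb C$ with $xv\ne zu$, let $\delta=\sqrt{xv-zu}$ and $\hat\delta=\sqrt{zu-xv}$ (with any choice of the two square roots), and let $$p=D_{\frac{zu-yw}{\delta^2}}\left(\tfrac{w-y}{\delta}\right),\quad q=D_{\frac{xv-yw}{\hat\delta^2}}\left(\tfrac{y-w}{\hat\delta}\right),\quad r=D_{\frac{xv-yw}{\delta^2}}\left(\tfrac{w-y}{\delta}\right),\quad s=D_{\frac{zu-yw}{\hat\delta^2}}\left(\tfrac{y-w}{\hat\delta}\right).$$ Then, for all complex $t$ in some neighbourhood of $0$, the series below converges, the denominator on the right is non-zero, and $$\sum_{n=0}^\infty P_n(x,y,z,w,u,v)\frac{t^n}{n!}=\frac{z\left(pq(w-y)+(\hat\delta ps-\delta qr)\right)e^{\frac{w-y}{2}t+\frac{\delta^2}{4}t^2}}{(\hat\delta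 s-qy)\,D_{\frac{zu-yw}{\delta^2}}\left(\delta t+\frac{w-y}{\delta}\right)+(pw-\delta r)\,D_{\frac{xv-yw}{\hat\delta^2}}\left(\hat\delta t+\frac{y-w}{\hat\delta}\right)} .$$ -/

import Mathlib

/-- The one-line word of a permutation `σ` of `[n]`, with the conventions `π₀ = 0` and (irrelevantly)
`π_i = 0` for `i > n`. The letters of `Fin n = {0, …, n-1}` are shifted by one, so that
`letterAt σ i = π_i ∈ {1, …, n}` for `1 ≤ i ≤ n`. -/
def letterAt {n : ℕ} (σ : Equiv.Perm (Fin n)) : ℕ → ℕ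
  | 0 => 0
  | i + 1 => if h : i < n then (σ ⟨i, h⟩ : ℕ) + 1 else 0

/-- The number of exterior peaks of pattern 132: indices `1 ≤ i ≤ n - 1` with
`π_{i-1} < π_i > π_{i+1}` and `π_{i-1} < π_{i+1}`. -/
def extPeaks132 {n : ℕ} (σ : Equiv.Perm (Fin n)) : ℕ :=
  ((Finset.Ico 1 n).filter fun i =>
    letterAt σ (i - 1) < letterAt σ i ∧ letterAt σ i > letterAt σ (i + 1) ∧
      letterAt σ (i - 1) < letterAt σ (i + 1)).card

/-- The number of exterior peaks of pattern 231: indices `1 ≤ i ≤ n - 1` with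
`π_{i-1} < π_i > π_{i+1}` and `π_{i-1} > π_{i+1}`. -/
def extPeaks231 {n : ℕ} (σ : Equiv.Perm (Fin n)) : ℕ :=
  ((Finset.Ico 1 n).filter fun i =>
    letterAt σ (i - 1) < letterAt σ i ∧ letterAt σ i > letterAt σ (i + 1) ∧
      letterAt σ (i - 1) > letterAt σ (i + 1)).card

/-- The number of proper double descents: indices `2 ≤ i ≤ n - 1` with
`π_{i-1} > π_i > π_{i+1}`. -/
def properDoubleDescents {n : ℕ} (σ : Equiv.Perm (Fin n)) : ℕ :=
  ((Finset.Ico 2 n).filter fun i =>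
    letterAt σ (i - 1) > letterAt σ i ∧ letterAt σ i > letterAt σ (i + 1)).card

/-- The polynomial `P_n(x, y, z, w, u, v)`, evaluated at complex numbers. The exponent of `w` is a
true difference: an exterior peak `i` accounts for the two letters at `i` and `i + 1`, a proper
double descent `i` for the letter at `i + 1`, and no letter is counted twice, so that
`2 (ep₁ + ep₂) + pdd ≤ n` for every permutation. -/
def peakPoly (n : ℕ) (x y z w u v : ℂ) : ℂ :=
  ∑ σ : Equiv.Perm (Fin n),
    x ^ extPeaks132 σ * v ^ extPeaks132 σ * u ^ extPeaks231 σ * z ^ (extPeaks231 σ + 1) *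
      y ^ properDoubleDescents σ *
      w ^ (n - 2 * (extPeaks132 σ + extPeaks231 σ) - properDoubleDescents σ)

/-- The confluent hypergeometric function `₁F₁(a; b; z) = ∑ (a)_k / (b)_k * z^k / k!`, an everywhere
convergent series when `b` is not one of `0, -1, -2, …` (it is used below for `b = 1/2, 3/2`). -/
noncomputable def kummerF (a b z : ℂ) : ℂ :=
  ∑' k : ℕ, (ascPochhammer ℂ k).eval a / (ascPochhammer ℂ k).eval b * (z ^ k / (k.factorial : ℂ))

/-- The parabolic cylinder function `D_a(z)`. At the poles of `Γ`, the value `Complex.Gamma _ = 0`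
makes `(Complex.Gamma _)⁻¹ = 0`, which is the value of the entire function `1 / Γ` there. -/
noncomputable def parabolicCylinderD (a z : ℂ) : ℂ :=
  (2 : ℂ) ^ (a / 2) * (√Real.pi : ℂ) * Complex.exp (-z ^ 2 / 4) *
    ((Complex.Gamma ((1 - a) / 2))⁻¹ * kummerF (-a / 2) (1 / 2) (z ^ 2 / 2) -
      (√2 : ℝ) * z * (Complex.Gamma (-a / 2))⁻¹ * kummerF ((1 - a) / 2) (3 / 2) (z ^ 2 / 2))

/-!
Insert the letter `n + 1` into a permutation of `[n]`. The gaps of the word are accounted for by its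
exterior peaks (two gaps each, before and after the peak), its proper double descents (the gap after
each), the remaining ascents and the end, and each insertion has a purely local effect: it turns a
peak of either pattern into a peak of pattern 132 with a proper double descent or into a peak of
pattern 231 with an ordinary ascent, a proper double descent into a peak of pattern 231, an ordinary
ascent into a peak of pattern 132, and at the end it adds an ordinary ascent. Hence `P_n` depends
only on `A = x v`, `B = z u`, `y`, `w` apart from the factor `z`, and `P_{n+1}` is the image of
`P_n` under the derivation `z ↦ z w`, `w ↦ A`, `y ↦ B`, `A, B ↦ A y + B w`
(`hasDerivAt_peakWeight`). If functions of `t` satisfy the corresponding differential system, the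
Taylor coefficients of `Z` at `0` are therefore the `P_n` (`hasSum_peakSum`).

The system is solvable because `A - B = δ²` is constant: `W - Y = c + δ² t` with `c = w - y`, so `W`
satisfies the Riccati equation `W' = W² - (c + δ² t) W + (x v - y w)`, and `Z = z / φ`, `W = -φ' / φ`
for a solution `φ` of a linear second order equation. Up to the Gaussian factor
`exp (c t / 2 + δ² t² / 4)` this is Weber's equation in the variable `δ t + c / δ`, solved by `D_a`
and by `D_{-a-1}` of the argument multiplied by `±i`.

For the parabolic cylinder functions the ladder relations `D_a' = (z / 2) D_a - D_{a+1}` and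
`D_a' = -(z / 2) D_a + a D_{a-1}` suffice; they follow from contiguous relations of `₁F₁`. They
express `p`, `q`, `r`, `s` as initial values of the two solutions and their derivatives, and the
denominator as the combination with the prescribed initial slope. Its value at `0` is a Wronskian,
which is constant along the line and is evaluated where both arguments vanish; by Euler's reflection
formula it is `δ' cos (π a / 2) + δ sin (π a / 2)`, which is non-zero as `δ'² = -δ²`
(`parabolicCylinderD_wronskian_ne_zero`).
-/

/-! ### The peak weight of a word and insertion of a maximal letter -/

/-- The weight of the word `l` read after the letter `c`, where `c` is not a peak: each peak of `l`
contributes `A` (pattern 132) or `B` (pattern 231), each proper double descent `y`, and each letter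
that is neither a peak nor directly preceded by a peak or a proper double descent contributes `w`.
A descent from `c` to the first letter of `l` makes `c` a proper double descent by convention; for
whole words `c = 0`, so that no such descent occurs. -/
def peakWeight (A B y w : ℂ) : ℕ → List ℕ → ℂ
  | _, [] => 1
  | c, [d] => if d < c then y else w
  | c, d :: e :: l =>
    if d < c then y * peakWeight A B y w d (e :: l)
    else if d < e then w * peakWeight A B y w d (e :: l)
    else (if c < e then A else B) * peakWeight A B y w e l

theorem peakWeight_of_lt {A B y w : ℂ} {c d : ℕ} (h : d < c) (l : List ℕ) :
    peakWeight A B y w c (d :: l) = y * peakWeight A B y w d l := by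
  cases l <;> simp [peakWeight, h]

theorem peakWeight_of_le_of_lt {A B y w : ℂ} {c d e : ℕ} (h : c ≤ d) (h' : d < e) (l : List ℕ) :
    peakWeight A B y w c (d :: e :: l) = w * peakWeight A B y w d (e :: l) := by
  simp [peakWeight, h.not_gt, h']

theorem peakWeight_peak {A B y w : ℂ} {c d e : ℕ} (h : c ≤ d) (h' : e ≤ d) (l : List ℕ) :
    peakWeight A B y w c (d :: e :: l) =
      (if c < e then A else B) * peakWeight A B y w e l := by
  simp [peakWeight, h.not_gt, h'.not_gt]

/-- Inserting a letter `m` exceeding all others at every position acts on the peak weight as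
multiplication by `w` (insertion at the end) plus the derivation
`w ↦ A`, `y ↦ B`, `A, B ↦ A y + B w`. -/
theorem hasDerivAt_peakWeight {fA fB fy fw : ℂ → ℂ} {t : ℂ}
    (hw : HasDerivAt fw (fA t) t) (hy : HasDerivAt fy (fB t) t)
    (hA : HasDerivAt fA (fA t * fy t + fB t * fw t) t)
    (hB : HasDerivAt fB (fA t * fy t + fB t * fw t) t) {m : ℕ} :
    ∀ (c : ℕ) (l : List ℕ), (c :: l).Nodup → (∀ b ∈ c :: l, b < m) →
      HasDerivAt (fun τ => peakWeight (fA τ) (fB τ) (fy τ) (fw τ) c l)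
        (((List.permutations'Aux m l).map (peakWeight (fA t) (fB t) (fy t) (fw t) c)).sum -
          fw t * peakWeight (fA t) (fB t) (fy t) (fw t) c l) t
  | c, [], _, hm => by
    have hc : c < m := hm c (by simp)
    simpa [peakWeight, hc.not_gt] using hasDerivAt_const t (1 : ℂ)
  | c, [d], hn, hm => by
    have hc : c < m := hm c (by simp)
    have hd : d < m := hm d (by simp)
    have hcd : c ≠ d := by rintro rfl; simp at hn
    rcases lt_or_gt_of_ne hcd with h | h
    · simpa [peakWeight, hc.not_gt, hd.not_gt, hd, h.not_gt, h] using hw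
    · simpa [peakWeight, hc.not_gt, hd.not_gt, hd, h.not_gt, h, mul_comm] using hy
  | c, d :: e :: l, hn, hm => by
    have hc : c < m := hm c (by simp)
    have hd : d < m := hm d (by simp)
    have he : e < m := hm e (by simp)
    have hcd : c ≠ d := by rintro rfl; simp at hn
    have hde : d ≠ e := by rintro rfl; simp at hn
    have ih := hasDerivAt_peakWeight hw hy hA hB d (e :: l) hn.of_cons
      fun b hb => hm b (List.mem_cons_of_mem _ hb)
    rcases lt_or_gt_of_ne hcd with h | h
    · rcases lt_or_gt_of_ne hde with h' | h'
      · have h0 : ∀ τ, peakWeight (fA τ) (fB τ) (fy τ) (fw τ) c (d :: e :: l) =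
            fw τ * peakWeight (fA τ) (fB τ) (fy τ) (fw τ) d (e :: l) :=
          fun τ => peakWeight_of_le_of_lt h.le h' l
        simp only [h0]
        convert! hw.mul ih using 1
        simp only [List.permutations'Aux, List.map_cons, List.map_map, List.sum_cons,
          Function.comp_def]
        simp only [peakWeight_peak hc.le hd.le, peakWeight_of_le_of_lt h.le h',
          peakWeight_of_le_of_lt h.le hd, List.sum_map_mul_left, h, if_true]
        ring
      · have ih' := hasDerivAt_peakWeight hw hy hA hB e l hn.of_cons.of_cons
          fun b hb => hm b (List.mem_cons_of_mem _ (List.mem_cons_of_mem _ hb))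
        have h0 : ∀ τ, peakWeight (fA τ) (fB τ) (fy τ) (fw τ) c (d :: e :: l) =
            (if c < e then fA τ else fB τ) * peakWeight (fA τ) (fB τ) (fy τ) (fw τ) e l :=
          fun τ => peakWeight_peak h.le h'.le l
        have hX : HasDerivAt (fun τ => if c < e then fA τ else fB τ)
            (fA t * fy t + fB t * fw t) t := by
          split_ifs
          exacts [hA, hB]
        simp only [h0]
        convert! hX.mul ih' using 1
        simp only [List.permutations'Aux, List.map_cons, List.map_map, List.sum_cons,
          Function.comp_def]
        simp only [peakWeight_peak hc.le hd.le, peakWeight_peak h.le h'.le,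
          peakWeight_of_le_of_lt h.le hd, peakWeight_peak hd.le he.le, peakWeight_of_lt h',
          List.sum_map_mul_left, h, h'.not_gt, if_true, if_false]
        ring
    · have h0 : ∀ τ, peakWeight (fA τ) (fB τ) (fy τ) (fw τ) c (d :: e :: l) =
          fy τ * peakWeight (fA τ) (fB τ) (fy τ) (fw τ) d (e :: l) :=
        fun τ => peakWeight_of_lt h (e :: l)
      simp only [h0]
      convert! hy.mul ih using 1
      rw [List.permutations'Aux]
      simp only [List.map_cons, List.map_map, List.sum_cons, Function.comp_def]
      simp only [peakWeight_of_lt h, peakWeight_peak hc.le hd.le, List.sum_map_mul_left,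
        h.not_gt, if_false]
      ring

/-! ### Counting peaks in a word -/

/-- The number of consecutive triples of letters of a word that satisfy `P`. -/
def tripleCount (P : ℕ → ℕ → ℕ → Prop) [∀ a b c, Decidable (P a b c)] : List ℕ → ℕ
  | a :: b :: c :: l => (if P a b c then 1 else 0) + tripleCount P (b :: c :: l)
  | _ => 0

theorem tripleCount_eq_card (P : ℕ → ℕ → ℕ → Prop) [∀ a b c, Decidable (P a b c)] :
    ∀ l : List ℕ, tripleCount P l = ((Finset.range (l.length - 2)).filter fun i =>
      P (l.getD i 0) (l.getD (i + 1) 0) (l.getD (i + 2) 0)).card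
  | [] => by simp [tripleCount]
  | [_] => by simp [tripleCount]
  | [_, _] => by simp [tripleCount]
  | a :: b :: c :: l => by
    rw [tripleCount, tripleCount_eq_card P (b :: c :: l), Finset.card_filter, Finset.card_filter]
    simp only [List.length_cons]
    rw [show l.length + 1 + 1 + 1 - 2 = l.length + 1 by omega,
      show l.length + 1 + 1 - 2 = l.length by omega, Finset.sum_range_succ', add_comm]
    rfl

/-- `1` if the word starts with a descent, else `0`. -/
def initialDescent : List ℕ → ℕ
  | c :: d :: _ => if d < c then 1 else 0
  | _ => 0

/-- A triple of letters whose middle letter is a peak of pattern 132. -/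
abbrev IsPeak132 (a b c : ℕ) : Prop := a < b ∧ b > c ∧ a < c

/-- A triple of letters whose middle letter is a peak of pattern 231. -/
abbrev IsPeak231 (a b c : ℕ) : Prop := a < b ∧ b > c ∧ a > c

/-- A triple of decreasing letters. -/
abbrev IsDoubleDescent (a b c : ℕ) : Prop := a > b ∧ b > c

theorem tripleCount_cons_cons_cons (P : ℕ → ℕ → ℕ → Prop) [∀ a b c, Decidable (P a b c)]
    (a b c : ℕ) (l : List ℕ) : tripleCount P (a :: b :: c :: l) =
      (if P a b c then 1 else 0) + tripleCount P (b :: c :: l) := rfl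

theorem tripleCount_cons_of_not {P : ℕ → ℕ → ℕ → Prop} [∀ a b c, Decidable (P a b c)]
    {a b : ℕ} (hP : ∀ c, ¬ P a b c) (l : List ℕ) :
    tripleCount P (a :: b :: l) = tripleCount P (b :: l) := by
  cases l <;> simp [tripleCount, hP]

theorem tripleCount_isDoubleDescent_cons (c : ℕ) : ∀ l : List ℕ,
    initialDescent (c :: l) = 1 → tripleCount IsDoubleDescent (c :: l) =
      initialDescent l + tripleCount IsDoubleDescent l
  | [] => by simp [initialDescent]
  | [d] => by simp [initialDescent, tripleCount]
  | d :: e :: l => by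
    intro h
    have h : d < c := by by_contra h'; simp [initialDescent, h'] at h
    simp [tripleCount, initialDescent, IsDoubleDescent, h]

/-- The peak weight is a monomial in the peak statistics. The exponent `k` of `w` is determined by
the length, since a peak accounts for two letters and a proper double descent for one. -/
theorem peakWeight_eq_pow (A B y w : ℂ) : ∀ (c : ℕ) (l : List ℕ), (c :: l).Nodup →
    ∃ k, peakWeight A B y w c l =
        A ^ tripleCount IsPeak132 (c :: l) * B ^ tripleCount IsPeak231 (c :: l) *
          y ^ (initialDescent (c :: l) + tripleCount IsDoubleDescent (c :: l)) * w ^ k ∧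
      2 * (tripleCount IsPeak132 (c :: l) + tripleCount IsPeak231 (c :: l)) +
        (initialDescent (c :: l) + tripleCount IsDoubleDescent (c :: l)) + k = l.length
  | c, [], _ => ⟨0, by simp [peakWeight, tripleCount, initialDescent]⟩
  | c, [d], _ => by
    by_cases h : d < c
    · exact ⟨0, by simp [peakWeight, tripleCount, initialDescent, h]⟩
    · exact ⟨1, by simp [peakWeight, tripleCount, initialDescent, h]⟩
  | c, d :: e :: l, hn => by
    have hcd : c ≠ d := by rintro rfl; simp at hn
    have hce : c ≠ e := by rintro rfl; simp at hn
    have hde : d ≠ e := by rintro rfl; simp at hn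
    obtain ⟨k, hk, hk'⟩ := peakWeight_eq_pow A B y w d (e :: l) hn.of_cons
    rcases lt_or_gt_of_ne hcd with h | h
    · have hi : initialDescent (c :: d :: e :: l) = 0 := by simp [initialDescent, h.le]
      rcases lt_or_gt_of_ne hde with h' | h'
      · have hi' : initialDescent (d :: e :: l) = 0 := by simp [initialDescent, h'.le]
        refine ⟨k + 1, ?_, ?_⟩
        · rw [peakWeight_of_le_of_lt h.le h', hk]
          simp only [tripleCount_cons_cons_cons, hi, hi', IsPeak132, IsPeak231, IsDoubleDescent,
            gt_iff_lt, h'.not_gt, h.not_gt, false_and, and_false, if_false, zero_add]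
          ring
        · simp only [tripleCount_cons_cons_cons, hi, hi', IsPeak132, IsPeak231, IsDoubleDescent,
            gt_iff_lt, h'.not_gt, h.not_gt, false_and, and_false, if_false, zero_add,
            List.length_cons] at hk' ⊢
          omega
      · obtain ⟨k, hk, hk'⟩ := peakWeight_eq_pow A B y w e l hn.of_cons.of_cons
        have hi' : initialDescent (d :: e :: l) = 1 := by simp [initialDescent, h']
        have h1 : tripleCount IsPeak132 (d :: e :: l) = tripleCount IsPeak132 (e :: l) :=
          tripleCount_cons_of_not (fun _ hh => h'.not_gt hh.1) l
        have h2 : tripleCount IsPeak231 (d :: e :: l) = tripleCount IsPeak231 (e :: l) :=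
          tripleCount_cons_of_not (fun _ hh => h'.not_gt hh.1) l
        have h3 := tripleCount_isDoubleDescent_cons d (e :: l) hi'
        refine ⟨k, ?_, ?_⟩
        · rw [peakWeight_peak h.le h'.le, hk, tripleCount_cons_cons_cons,
            tripleCount_cons_cons_cons, tripleCount_cons_cons_cons IsDoubleDescent, hi, h1, h2, h3]
          rcases lt_or_gt_of_ne hce with h'' | h''
          · simp only [IsPeak132, IsPeak231, IsDoubleDescent, gt_iff_lt, h, h', h'', h''.not_gt,
              h.not_gt, false_and, and_false, and_self, if_true, if_false, zero_add]
            ring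
          · simp only [IsPeak132, IsPeak231, IsDoubleDescent, gt_iff_lt, h, h', h'', h''.not_gt,
              h.not_gt, false_and, and_false, and_self, if_true, if_false, zero_add]
            ring
        · rw [tripleCount_cons_cons_cons,
            tripleCount_cons_cons_cons, tripleCount_cons_cons_cons IsDoubleDescent, hi, h1, h2, h3]
          rcases lt_or_gt_of_ne hce with h'' | h''
          · simp only [IsPeak132, IsPeak231, IsDoubleDescent, gt_iff_lt, h, h', h'', h''.not_gt,
              h.not_gt, false_and, and_false, and_self, if_true, if_false, zero_add,
              List.length_cons]
            omega
          · simp only [IsPeak132, IsPeak231, IsDoubleDescent, gt_iff_lt, h, h', h'', h''.not_gt,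
              h.not_gt, false_and, and_false, and_self, if_true, if_false, zero_add,
              List.length_cons]
            omega
    · have hi : initialDescent (c :: d :: e :: l) = 1 := by simp [initialDescent, h]
      have h1 : tripleCount IsPeak132 (c :: d :: e :: l) = tripleCount IsPeak132 (d :: e :: l) :=
        tripleCount_cons_of_not (fun _ hh => h.not_gt hh.1) _
      have h2 : tripleCount IsPeak231 (c :: d :: e :: l) = tripleCount IsPeak231 (d :: e :: l) :=
        tripleCount_cons_of_not (fun _ hh => h.not_gt hh.1) _
      have h3 := tripleCount_isDoubleDescent_cons c (d :: e :: l) hi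
      refine ⟨k, ?_, ?_⟩
      · rw [peakWeight_of_lt h, hk, hi, h1, h2, h3]
        ring
      · rw [hi, h1, h2, h3, List.length_cons]
        omega

/-! ### From permutations to words -/

/-- The word `π₁ ⋯ πₙ` of a permutation of `[n]`. -/
def permWord {n : ℕ} (σ : Equiv.Perm (Fin n)) : List ℕ := List.ofFn fun i => (σ i : ℕ) + 1

theorem letterAt_eq_getD {n : ℕ} (σ : Equiv.Perm (Fin n)) (i : ℕ) :
    letterAt σ i = (0 :: permWord σ).getD i 0 := by
  cases i with
  | zero => rfl
  | succ i =>
    by_cases h : i < n <;> simp [letterAt, permWord, h]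

theorem tripleCount_permWord {n : ℕ} (σ : Equiv.Perm (Fin n)) (P : ℕ → ℕ → ℕ → Prop)
    [∀ a b c, Decidable (P a b c)] : tripleCount P (0 :: permWord σ) =
      ((Finset.Ico 1 n).filter fun i =>
        P (letterAt σ (i - 1)) (letterAt σ i) (letterAt σ (i + 1))).card := by
  rw [tripleCount_eq_card, Finset.card_filter, Finset.card_filter, Finset.sum_Ico_eq_sum_range]
  simp only [letterAt_eq_getD]
  have hl : (0 :: permWord σ).length - 2 = n - 1 := by simp [permWord]
  rw [hl]
  refine Finset.sum_congr rfl fun i _ => ?_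
  rw [show 1 + i - 1 = i by omega, show 1 + i = i + 1 by omega]

theorem nodup_permWord {n : ℕ} (σ : Equiv.Perm (Fin n)) : (permWord σ).Nodup := by
  refine List.nodup_ofFn.2 fun i j h => σ.injective (Fin.ext ?_)
  simpa using h

theorem mem_permWord {n : ℕ} (σ : Equiv.Perm (Fin n)) (k : ℕ) :
    k ∈ permWord σ ↔ 1 ≤ k ∧ k ≤ n := by
  rw [permWord, List.mem_ofFn]
  constructor
  · rintro ⟨i, rfl⟩
    exact ⟨by simp, (σ i).isLt⟩
  · rintro ⟨h1, h2⟩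
    exact ⟨σ.symm ⟨k - 1, by omega⟩, by simp; omega⟩

/-- No index is lost by starting the count at `2`, since `π₀ = 0` begins no descent. -/
theorem properDoubleDescents_eq {n : ℕ} (σ : Equiv.Perm (Fin n)) :
    properDoubleDescents σ = tripleCount IsDoubleDescent (0 :: permWord σ) := by
  rw [tripleCount_permWord, properDoubleDescents]
  congr 1
  ext i
  simp only [Finset.mem_filter, Finset.mem_Ico]
  refine ⟨fun h => ⟨⟨by omega, h.1.2⟩, h.2⟩, fun h => ⟨⟨?_, h.1.2⟩, h.2⟩⟩
  by_contra hi
  obtain rfl : i = 1 := by omega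
  simpa [letterAt] using h.2.1

theorem peakPoly_term_eq_peakWeight {n : ℕ} (σ : Equiv.Perm (Fin n)) (x y z w u v : ℂ) :
    x ^ extPeaks132 σ * v ^ extPeaks132 σ * u ^ extPeaks231 σ * z ^ (extPeaks231 σ + 1) *
      y ^ properDoubleDescents σ *
      w ^ (n - 2 * (extPeaks132 σ + extPeaks231 σ) - properDoubleDescents σ) =
    z * peakWeight (x * v) (z * u) y w 0 (permWord σ) := by
  have hn : (0 :: permWord σ).Nodup :=
    List.nodup_cons.2 ⟨by simp [mem_permWord], nodup_permWord σ⟩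
  obtain ⟨k, hk, hk'⟩ := peakWeight_eq_pow (x * v) (z * u) y w 0 (permWord σ) hn
  have h0 : initialDescent (0 :: permWord σ) = 0 := by
    cases permWord σ <;> simp [initialDescent]
  have hlen : (permWord σ).length = n := by simp [permWord]
  have h1 : extPeaks132 σ = tripleCount IsPeak132 (0 :: permWord σ) :=
    (tripleCount_permWord σ IsPeak132).symm
  have h2 : extPeaks231 σ = tripleCount IsPeak231 (0 :: permWord σ) :=
    (tripleCount_permWord σ IsPeak231).symm
  rw [h0, hlen, zero_add, ← h1, ← h2, ← properDoubleDescents_eq] at hk'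
  rw [hk, h0, zero_add, ← h1, ← h2, ← properDoubleDescents_eq,
    show n - 2 * (extPeaks132 σ + extPeaks231 σ) - properDoubleDescents σ = k by omega]
  ring

/-- The word `n (n-1) ⋯ 1`. -/
def descWord : ℕ → List ℕ
  | 0 => []
  | n + 1 => (n + 1) :: descWord n

theorem mem_descWord {n k : ℕ} : k ∈ descWord n ↔ 1 ≤ k ∧ k ≤ n := by
  induction n with
  | zero => simp [descWord]; omega
  | succ n ih => simp [descWord, ih]; omega

theorem nodup_descWord (n : ℕ) : (descWord n).Nodup := by
  induction n with
  | zero => simp [descWord]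
  | succ n ih => exact List.nodup_cons.2 ⟨by simp [mem_descWord], ih⟩

theorem length_descWord (n : ℕ) : (descWord n).length = n := by
  induction n with
  | zero => rfl
  | succ n ih => simp [descWord, ih]

theorem sum_perm_eq_sum_permutations' (n : ℕ) (f : List ℕ → ℂ) :
    ∑ σ : Equiv.Perm (Fin n), f (permWord σ) = ((descWord n).permutations'.map f).sum := by
  classical
  have hnd : (descWord n).permutations'.Nodup :=
    (List.permutations_perm_permutations' _).nodup_iff.1
      (List.nodup_permutations _ (nodup_descWord n))
  rw [← List.sum_toFinset f hnd]
  have hinj : Function.Injective (permWord (n := n)) := by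
    intro σ τ h
    refine Equiv.ext fun i => Fin.ext ?_
    simpa using congrFun (List.ofFn_injective h) i
  have himg : Finset.univ.image (permWord (n := n)) = (descWord n).permutations'.toFinset := by
    refine Finset.eq_of_subset_of_card_le ?_ ?_
    · intro l hl
      obtain ⟨σ, -, rfl⟩ := Finset.mem_image.1 hl
      rw [List.mem_toFinset, List.mem_permutations',
        List.perm_ext_iff_of_nodup (nodup_permWord σ) (nodup_descWord n)]
      intro k
      rw [mem_permWord, mem_descWord]
    · rw [Finset.card_image_of_injective _ hinj, List.toFinset_card_of_nodup hnd,
        ← (List.permutations_perm_permutations' _).length_eq, List.length_permutations,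
        length_descWord, Finset.card_univ, Fintype.card_perm, Fintype.card_fin]
  rw [← himg, Finset.sum_image hinj.injOn]

/-- The sum of the peak weights of all arrangements of the letters `1, …, n`; this is `P_n / z` as a
polynomial in `A = x v`, `B = z u`, `y` and `w`. -/
noncomputable def peakSum (n : ℕ) (A B y w : ℂ) : ℂ :=
  ((descWord n).permutations'.map (peakWeight A B y w 0)).sum

theorem peakPoly_eq_peakSum (n : ℕ) (x y z w u v : ℂ) :
    peakPoly n x y z w u v = z * peakSum n (x * v) (z * u) y w := by
  rw [peakPoly, peakSum, ← sum_perm_eq_sum_permutations', Finset.mul_sum]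
  exact Finset.sum_congr rfl fun σ _ => peakPoly_term_eq_peakWeight σ x y z w u v

/-- Every arrangement of `1, …, n + 1` arises once by inserting `n + 1` into one of `1, …, n`. -/
theorem peakSum_succ (n : ℕ) (A B y w : ℂ) : peakSum (n + 1) A B y w =
    ((descWord n).permutations'.map fun l =>
      ((List.permutations'Aux (n + 1) l).map (peakWeight A B y w 0)).sum).sum := by
  rw [peakSum, descWord, List.permutations']
  induction (descWord n).permutations' with
  | nil => rfl
  | cons a l ih => rw [List.flatMap_cons, List.map_append, List.sum_append, ih]; rfl

theorem hasDerivAt_list_sum {ι : Type*} {f : ι → ℂ → ℂ} {f' : ι → ℂ} {t : ℂ} (l : List ι)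
    (h : ∀ i ∈ l, HasDerivAt (f i) (f' i) t) :
    HasDerivAt (fun τ => (l.map fun i => f i τ).sum) (l.map f').sum t := by
  induction l with
  | nil => simpa using hasDerivAt_const t (0 : ℂ)
  | cons a l ih =>
    simp only [List.map_cons, List.sum_cons]
    exact (h a (by simp)).add (ih fun i hi => h i (by simp [hi]))

theorem hasDerivAt_peakSum {fA fB fy fw : ℂ → ℂ} {t : ℂ}
    (hw : HasDerivAt fw (fA t) t) (hy : HasDerivAt fy (fB t) t)
    (hA : HasDerivAt fA (fA t * fy t + fB t * fw t) t)
    (hB : HasDerivAt fB (fA t * fy t + fB t * fw t) t) (n : ℕ) :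
    HasDerivAt (fun τ => peakSum n (fA τ) (fB τ) (fy τ) (fw τ))
      (peakSum (n + 1) (fA t) (fB t) (fy t) (fw t) -
        fw t * peakSum n (fA t) (fB t) (fy t) (fw t)) t := by
  have key := hasDerivAt_list_sum (descWord n).permutations' (t := t) fun l hl => by
    have hmem : ∀ b, b ∈ l ↔ 1 ≤ b ∧ b ≤ n := fun b => by
      rw [(List.mem_permutations'.1 hl).mem_iff, mem_descWord]
    have hnd : l.Nodup := (List.mem_permutations'.1 hl).nodup_iff.2 (nodup_descWord n)
    refine hasDerivAt_peakWeight hw hy hA hB (m := n + 1) 0 l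
      (List.nodup_cons.2 ⟨by simp [hmem], hnd⟩) fun b hb => ?_
    rcases List.mem_cons.1 hb with rfl | hb
    · exact Nat.succ_pos n
    · exact Nat.lt_succ_of_le ((hmem b).1 hb).2
  convert! key using 1
  rw [peakSum_succ, peakSum, ← List.sum_map_mul_left]
  induction (descWord n).permutations' with
  | nil => simp
  | cons a l ih =>
    simp only [List.map_cons, List.sum_cons] at ih ⊢
    linear_combination ih

/-! ### Exponential generating series -/

theorem summable_mul_pow_div_factorial {c : ℕ → ℂ} {R : ℝ} (hc : ∀ k, ‖c k‖ ≤ R ^ k) (x : ℂ) :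
    Summable fun k => c k * (x ^ k / (k.factorial : ℂ)) := by
  refine Summable.of_norm_bounded (Real.summable_pow_div_factorial (R * ‖x‖)) fun k => ?_
  rw [norm_mul, norm_div, norm_pow, Complex.norm_natCast, mul_pow, mul_div_assoc]
  gcongr
  exact hc k

theorem hasDerivAt_tsum_mul_pow_div_factorial {c : ℕ → ℂ} {R : ℝ} (hR : 0 ≤ R)
    (hc : ∀ k, ‖c k‖ ≤ R ^ k) (x : ℂ) :
    HasDerivAt (fun x => ∑' k, c k * (x ^ k / (k.factorial : ℂ)))
      (∑' k, c (k + 1) * (x ^ k / (k.factorial : ℂ))) x := by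
  set g' : ℕ → ℂ → ℂ := fun k x => c k * (k * x ^ (k - 1) / (k.factorial : ℂ)) with hg'
  set u : ℕ → ℝ := fun k => R ^ k * (k * (‖x‖ + 1) ^ (k - 1) / (k.factorial : ℝ)) with hu'
  -- The termwise derivatives are bounded uniformly on the ball of radius `‖x‖ + 1`.
  have hu : Summable u := by
    rw [← summable_nat_add_iff 1]
    refine ((Real.summable_pow_div_factorial (R * (‖x‖ + 1))).mul_left R).congr fun k => ?_
    simp only [hu', Nat.add_sub_cancel, Nat.factorial_succ]
    push_cast
    have : (k.factorial : ℝ) ≠ 0 := by positivity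
    have : (k + 1 : ℝ) ≠ 0 := by positivity
    rw [mul_pow]
    field_simp
    ring
  have hx : x ∈ Metric.ball (0 : ℂ) (‖x‖ + 1) := by simp
  have hd := hasDerivAt_tsum_of_isPreconnected (g' := g') hu Metric.isOpen_ball
    (convex_ball (0 : ℂ) (‖x‖ + 1)).isPreconnected
    (fun k y _ => ((hasDerivAt_pow k y).div_const (k.factorial : ℂ)).const_mul (c k))
    (fun k y hy => ?_) hx (summable_mul_pow_div_factorial hc x) hx
  · convert! hd using 1
    have hs : Summable fun k => g' k x := by
      refine Summable.of_norm_bounded hu fun k => ?_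
      simp only [hg', hu', norm_mul, norm_div, norm_pow, Complex.norm_natCast]
      gcongr
      exacts [hc k, by simp]
    rw [hs.tsum_eq_zero_add]
    simp only [hg', Nat.add_sub_cancel, Nat.factorial_succ, Nat.cast_zero, zero_mul, zero_div,
      mul_zero, zero_add]
    refine tsum_congr fun k => ?_
    push_cast
    have : (k.factorial : ℂ) ≠ 0 := by exact_mod_cast k.factorial_ne_zero
    have : (k + 1 : ℂ) ≠ 0 := by exact_mod_cast k.succ_ne_zero
    field_simp
  · simp only [hg', hu', norm_mul, norm_div, norm_pow, Complex.norm_natCast]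
    have : ‖y‖ ≤ ‖x‖ + 1 := by simpa using (Metric.mem_ball.1 hy).le
    gcongr
    exact hc k

/-- Multiplication by `x` shifts the coefficients of an exponential generating series. -/
theorem HasSum.mul_pow_div_factorial_shift {c e : ℕ → ℂ} (he0 : e 0 = 0)
    (he : ∀ k : ℕ, e (k + 1) = (k + 1) * c k) {x S : ℂ}
    (h : HasSum (fun k => c k * (x ^ k / (k.factorial : ℂ))) S) :
    HasSum (fun k => e k * (x ^ k / (k.factorial : ℂ))) (x * S) := by
  rw [← hasSum_nat_add_iff' 1]
  simp only [Finset.range_one, Finset.sum_singleton, he0, zero_mul, sub_zero]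
  convert! h.mul_left x using 2 with k
  rw [he, Nat.factorial_succ]
  push_cast
  have : (k.factorial : ℂ) ≠ 0 := by exact_mod_cast k.factorial_ne_zero
  have : (k + 1 : ℂ) ≠ 0 := by exact_mod_cast k.succ_ne_zero
  field_simp
  ring

/-! ### Kummer's function -/

/-- The coefficient `(a)_k / (b)_k` of `z ^ k / k!` in Kummer's series. -/
noncomputable def kummerCoeff (a b : ℂ) (k : ℕ) : ℂ :=
  (ascPochhammer ℂ k).eval a / (ascPochhammer ℂ k).eval b

theorem add_natCast_ne_zero_of_half_le {b : ℂ} (hb : 1 / 2 ≤ b.re) (k : ℕ) : b + k ≠ 0 := by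
  intro h
  have := congrArg Complex.re h
  simp at this
  have : (0 : ℝ) ≤ k := k.cast_nonneg
  linarith

theorem ascPochhammer_eval_ne_zero_of_half_le {b : ℂ} (hb : 1 / 2 ≤ b.re) (k : ℕ) :
    (ascPochhammer ℂ k).eval b ≠ 0 := by
  induction k with
  | zero => simp
  | succ k ih =>
    rw [ascPochhammer_succ_eval]
    exact mul_ne_zero ih (add_natCast_ne_zero_of_half_le hb k)

theorem ascPochhammer_succ_eval_left (a : ℂ) (k : ℕ) :
    (ascPochhammer ℂ (k + 1)).eval a = a * (ascPochhammer ℂ k).eval (a + 1) := by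
  simp [ascPochhammer_succ_left]

theorem kummerCoeff_zero (a b : ℂ) : kummerCoeff a b 0 = 1 := by simp [kummerCoeff]

theorem kummerCoeff_succ (a b : ℂ) (k : ℕ) :
    kummerCoeff a b (k + 1) = kummerCoeff a b k * ((a + k) / (b + k)) := by
  rw [kummerCoeff, ascPochhammer_succ_eval, ascPochhammer_succ_eval, mul_div_mul_comm, kummerCoeff]

theorem norm_kummerCoeff_le (a : ℂ) {b : ℂ} (hb : 1 / 2 ≤ b.re) (k : ℕ) :
    ‖kummerCoeff a b k‖ ≤ (2 * ‖a‖ + 1) ^ k := by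
  induction k with
  | zero => simp [kummerCoeff_zero]
  | succ k ih =>
    rw [kummerCoeff_succ, norm_mul, pow_succ]
    gcongr
    have h1 : (1 / 2 + k : ℝ) ≤ ‖b + k‖ := by
      refine le_trans ?_ (Complex.re_le_norm _)
      simp only [Complex.add_re, Complex.natCast_re]
      linarith
    have h2 : ‖a + k‖ ≤ ‖a‖ + k := by simpa using norm_add_le a (k : ℂ)
    have h3 : (0 : ℝ) ≤ k := k.cast_nonneg
    rw [norm_div, div_le_iff₀ (by linarith)]
    nlinarith [norm_nonneg a]

theorem hasSum_kummerF (a : ℂ) {b : ℂ} (hb : 1 / 2 ≤ b.re) (x : ℂ) :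
    HasSum (fun k => kummerCoeff a b k * (x ^ k / (k.factorial : ℂ))) (kummerF a b x) :=
  (summable_mul_pow_div_factorial (norm_kummerCoeff_le a hb) x).hasSum

theorem kummerCoeff_succ_eq (a b : ℂ) (k : ℕ) :
    kummerCoeff a b (k + 1) = a / b * kummerCoeff (a + 1) (b + 1) k := by
  rw [kummerCoeff, ascPochhammer_succ_eval_left, ascPochhammer_succ_eval_left, mul_div_mul_comm,
    kummerCoeff]

theorem hasDerivAt_kummerF (a : ℂ) {b : ℂ} (hb : 1 / 2 ≤ b.re) (x : ℂ) :
    HasDerivAt (kummerF a b) (a / b * kummerF (a + 1) (b + 1) x) x := by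
  have h := hasDerivAt_tsum_mul_pow_div_factorial (by positivity) (norm_kummerCoeff_le a hb) x
  simp only [kummerCoeff_succ_eq, mul_assoc, tsum_mul_left] at h
  exact h

theorem half_le_re_add_one {b : ℂ} (hb : 1 / 2 ≤ b.re) : 1 / 2 ≤ (b + 1).re := by
  simp only [Complex.add_re, Complex.one_re]
  linarith

theorem kummerCoeff_eq_add_one_right (a : ℂ) {b : ℂ} (hb : 1 / 2 ≤ b.re) (k : ℕ) :
    b * kummerCoeff a b k = (b + k) * kummerCoeff a (b + 1) k := by
  have h := ascPochhammer_succ_eval_left b k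
  rw [ascPochhammer_succ_eval] at h
  have h1 := ascPochhammer_eval_ne_zero_of_half_le hb k
  have h2 := ascPochhammer_eval_ne_zero_of_half_le (half_le_re_add_one hb) k
  rw [kummerCoeff, kummerCoeff]
  field_simp
  linear_combination -(ascPochhammer ℂ k).eval a * h

theorem kummerCoeff_add_one_left (a b : ℂ) (k : ℕ) :
    a * kummerCoeff (a + 1) b k = (a + k) * kummerCoeff a b k := by
  have h := ascPochhammer_succ_eval_left a k
  rw [ascPochhammer_succ_eval] at h
  rw [kummerCoeff, kummerCoeff, ← mul_div_assoc, ← mul_div_assoc, ← h, mul_comm]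

/-- In terms of `M = ₁F₁(a; b; ·)`, this says `b (M' - M) = (a - b) ₁F₁(a; b + 1; ·)`. -/
theorem kummerF_contiguous_right (a : ℂ) {b : ℂ} (hb : 1 / 2 ≤ b.re) (x : ℂ) :
    a * kummerF (a + 1) (b + 1) x - b * kummerF a b x = (a - b) * kummerF a (b + 1) x := by
  have hb' := half_le_re_add_one hb
  refine (((hasSum_kummerF (a + 1) hb' x).mul_left a).sub
    ((hasSum_kummerF a hb x).mul_left b)).unique ?_
  convert! (hasSum_kummerF a hb' x).mul_left (a - b) using 2 with k
  linear_combination (x ^ k / (k.factorial : ℂ)) * (kummerCoeff_add_one_left a (b + 1) k -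
    kummerCoeff_eq_add_one_right a hb k)

/-- In terms of `M = ₁F₁(a; b + 1; ·)`, this says `x M' + b M = b ₁F₁(a; b; x)`. -/
theorem kummerF_contiguous_deriv (a : ℂ) {b : ℂ} (hb : 1 / 2 ≤ b.re) (x : ℂ) :
    x * (a / (b + 1) * kummerF (a + 1) (b + 1 + 1) x) + b * kummerF a (b + 1) x =
      b * kummerF a b x := by
  have hb' := half_le_re_add_one hb
  have h1 : HasSum (fun k => kummerCoeff a (b + 1) (k + 1) * (x ^ k / (k.factorial : ℂ)))
      (a / (b + 1) * kummerF (a + 1) (b + 1 + 1) x) := by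
    simp only [kummerCoeff_succ_eq, mul_assoc]
    exact (hasSum_kummerF (a + 1) (half_le_re_add_one hb') x).mul_left _
  have h2 := h1.mul_pow_div_factorial_shift (e := fun k => k * kummerCoeff a (b + 1) k)
    (by simp) (by simp)
  refine (h2.add ((hasSum_kummerF a hb' x).mul_left b)).unique ?_
  convert! (hasSum_kummerF a hb x).mul_left b using 2 with k
  linear_combination -(x ^ k / (k.factorial : ℂ)) * kummerCoeff_eq_add_one_right a hb k

theorem kummerF_contiguous_left (a : ℂ) {b : ℂ} (hb : 1 / 2 ≤ b.re) (x : ℂ) :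
    b * (kummerF (a + 1) b x - kummerF a b x) = x * kummerF (a + 1) (b + 1) x := by
  have hb' := half_le_re_add_one hb
  have hb0 : b ≠ 0 := by simpa using add_natCast_ne_zero_of_half_le hb 0
  refine (((hasSum_kummerF (a + 1) hb x).sub (hasSum_kummerF a hb x)).mul_left b).unique ?_
  have h := (hasSum_kummerF (a + 1) hb' x).mul_pow_div_factorial_shift
    (e := fun k => b * (kummerCoeff (a + 1) b k - kummerCoeff a b k))
    (by simp [kummerCoeff_zero]) fun k => by
      have h1 := kummerCoeff_eq_add_one_right (a + 1) hb k
      have h2 := add_natCast_ne_zero_of_half_le hb k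
      rw [kummerCoeff_succ_eq a, kummerCoeff_succ]
      field_simp
      linear_combination (a + 1 + k) * h1
  convert! h using 2 with k
  ring

/-! ### The parabolic cylinder function -/

/-- The coefficient of the even solution in `D_a`, that is, `D_a(0)`. -/
noncomputable def pcfEven (a : ℂ) : ℂ :=
  (2 : ℂ) ^ (a / 2) * (√Real.pi : ℂ) * (Complex.Gamma ((1 - a) / 2))⁻¹

/-- The coefficient of the odd solution in `D_a`, that is, `D_a'(0)`. -/
noncomputable def pcfOdd (a : ℂ) : ℂ :=
  -((2 : ℂ) ^ (a / 2) * (√Real.pi : ℂ) * (√2 : ℝ) * (Complex.Gamma (-a / 2))⁻¹)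

theorem parabolicCylinderD_eq (a z : ℂ) : parabolicCylinderD a z =
    Complex.exp (-z ^ 2 / 4) * (pcfEven a * kummerF (-a / 2) (1 / 2) (z ^ 2 / 2) +
      pcfOdd a * (z * kummerF ((1 - a) / 2) (3 / 2) (z ^ 2 / 2))) := by
  rw [parabolicCylinderD, pcfEven, pcfOdd]
  ring

theorem two_cpow_add_one_div_two (a : ℂ) : (2 : ℂ) ^ ((a + 1) / 2) = 2 ^ (a / 2) * (√2 : ℝ) := by
  rw [add_div, Complex.cpow_add _ _ two_ne_zero, Real.sqrt_eq_rpow,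
    Complex.ofReal_cpow (by norm_num)]
  norm_num

theorem pcfEven_add_one (a : ℂ) : pcfEven (a + 1) = -pcfOdd a := by
  rw [pcfEven, pcfOdd, two_cpow_add_one_div_two, show (1 - (a + 1)) / 2 = -a / 2 by ring]
  ring

theorem pcfOdd_add_one (a : ℂ) : pcfOdd (a + 1) = (a + 1) * pcfEven a := by
  have h2 : ((√2 : ℝ) : ℂ) * (√2 : ℝ) = 2 := by
    rw [← Complex.ofReal_mul, Real.mul_self_sqrt (by norm_num)]
    norm_num
  rw [pcfEven, pcfOdd, two_cpow_add_one_div_two,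
    Complex.one_div_Gamma_eq_self_mul_one_div_Gamma_add_one,
    show -(a + 1) / 2 + 1 = (1 - a) / 2 by ring]
  linear_combination ((a + 1) / 2 * (2 : ℂ) ^ (a / 2) * (√Real.pi : ℂ) *
    (Complex.Gamma ((1 - a) / 2))⁻¹) * h2

theorem hasDerivAt_kummerF_sq (a : ℂ) {b : ℂ} (hb : 1 / 2 ≤ b.re) (z : ℂ) :
    HasDerivAt (fun z => kummerF a b (z ^ 2 / 2))
      (z * (a / b * kummerF (a + 1) (b + 1) (z ^ 2 / 2))) z := by
  have h := (hasDerivAt_kummerF a hb (z ^ 2 / 2)).comp z ((hasDerivAt_pow 2 z).div_const 2)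
  convert! h using 1
  push_cast
  ring

theorem hasDerivAt_exp_neg_sq_div_four (z : ℂ) :
    HasDerivAt (fun z : ℂ => Complex.exp (-z ^ 2 / 4))
      (Complex.exp (-z ^ 2 / 4) * (-z / 2)) z := by
  have h : HasDerivAt (fun z : ℂ => -z ^ 2 / 4) (-z / 2) z := by
    convert! ((hasDerivAt_pow 2 z).neg).div_const 4 using 1
    push_cast
    ring
  exact h.cexp

theorem half_le_re_half : 1 / 2 ≤ (1 / 2 : ℂ).re := by norm_num

theorem half_le_re_three_halves : 1 / 2 ≤ (3 / 2 : ℂ).re := by norm_num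

/-- The derivative of `D_a` computed from the derivatives of the even and odd solutions. -/
theorem hasDerivAt_parabolicCylinderD (a z : ℂ) :
    HasDerivAt (parabolicCylinderD a)
      (-(z / 2) * parabolicCylinderD a z + Complex.exp (-z ^ 2 / 4) *
        (pcfEven a * (-a * (z * kummerF (1 - a / 2) (3 / 2) (z ^ 2 / 2))) +
          pcfOdd a * kummerF ((1 - a) / 2) (1 / 2) (z ^ 2 / 2))) z := by
  have h1 := hasDerivAt_kummerF_sq (-a / 2) half_le_re_half z
  have h2 := (hasDerivAt_id z).mul (hasDerivAt_kummerF_sq ((1 - a) / 2) half_le_re_three_halves z)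
  have h := (hasDerivAt_exp_neg_sq_div_four z).mul
    ((h1.const_mul (pcfEven a)).add (h2.const_mul (pcfOdd a)))
  have hD : parabolicCylinderD a = _ := funext (parabolicCylinderD_eq a)
  rw [hD]
  convert! h using 1
  have h3 := kummerF_contiguous_deriv ((1 - a) / 2) half_le_re_half (z ^ 2 / 2)
  rw [show (1 / 2 : ℂ) + 1 = 3 / 2 by norm_num] at h3 ⊢
  rw [show -a / 2 + 1 = 1 - a / 2 by ring]
  simp only [id_eq, Pi.add_apply, Pi.mul_apply]
  linear_combination -(2 * Complex.exp (-z ^ 2 / 4) * pcfOdd a) * h3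

/-- `D_a' = -(z / 2) D_a + a D_{a-1}`, written with `a + 1` for `a`. -/
theorem hasDerivAt_parabolicCylinderD_down (a z : ℂ) :
    HasDerivAt (parabolicCylinderD (a + 1))
      (-(z / 2) * parabolicCylinderD (a + 1) z + (a + 1) * parabolicCylinderD a z) z := by
  convert! hasDerivAt_parabolicCylinderD (a + 1) z using 2
  rw [parabolicCylinderD_eq, pcfEven_add_one, pcfOdd_add_one,
    show 1 - (a + 1) / 2 = (1 - a) / 2 by ring, show (1 - (a + 1)) / 2 = -a / 2 by ring]
  ring

/-- `D_a' = (z / 2) D_a - D_{a+1}`. -/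
theorem hasDerivAt_parabolicCylinderD_up (a z : ℂ) :
    HasDerivAt (parabolicCylinderD a)
      (z / 2 * parabolicCylinderD a z - parabolicCylinderD (a + 1) z) z := by
  convert! hasDerivAt_parabolicCylinderD a z using 1
  rw [parabolicCylinderD_eq, parabolicCylinderD_eq, pcfEven_add_one, pcfOdd_add_one,
    show (1 - (a + 1)) / 2 = -a / 2 by ring]
  have h1 := kummerF_contiguous_right (-a / 2) half_le_re_half (z ^ 2 / 2)
  have h2 := kummerF_contiguous_left (-(a + 1) / 2) half_le_re_half (z ^ 2 / 2)
  rw [show (1 / 2 : ℂ) + 1 = 3 / 2 by norm_num] at h1 h2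
  rw [show -a / 2 + 1 = 1 - a / 2 by ring] at h1
  rw [show -(a + 1) / 2 + 1 = (1 - a) / 2 by ring] at h2
  linear_combination -(2 * Complex.exp (-z ^ 2 / 4)) * (pcfEven a * z * h1 + pcfOdd a * h2)

theorem parabolicCylinderD_zero (a : ℂ) : parabolicCylinderD a 0 = pcfEven a := by
  have h : kummerF (-a / 2) (1 / 2) 0 = 1 := by
    have h1 := hasSum_kummerF (-a / 2) half_le_re_half 0
    refine h1.unique ?_
    convert! hasSum_single (α := ℂ) 0 _ using 1
    · simp [kummerCoeff_zero]
    · intro k hk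
      simp [hk]
  rw [parabolicCylinderD_eq, show (0 : ℂ) ^ 2 / 2 = 0 by norm_num, h]
  simp

/-- `D_a(0) D_{-a}(0) = cos (π a / 2)`, by Euler's reflection formula. -/
theorem parabolicCylinderD_zero_mul_neg (a : ℂ) :
    parabolicCylinderD a 0 * parabolicCylinderD (-a) 0 = Complex.cos (Real.pi * a / 2) := by
  have hpi : (Real.pi : ℂ) ≠ 0 := Complex.ofReal_ne_zero.mpr Real.pi_ne_zero
  have h1 := Complex.Gamma_mul_Gamma_one_sub ((1 - a) / 2)
  rw [show 1 - (1 - a) / 2 = (1 - -a) / 2 by ring,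
    show Real.pi * ((1 - a) / 2) = Real.pi / 2 - Real.pi * a / 2 by ring,
    Complex.sin_pi_div_two_sub] at h1
  have h2 : (2 : ℂ) ^ (a / 2) * 2 ^ (-a / 2) = 1 := by
    rw [← Complex.cpow_add _ _ two_ne_zero, neg_div, add_neg_cancel, Complex.cpow_zero]
  have h3 : (√Real.pi : ℂ) * (√Real.pi : ℂ) = Real.pi := by
    rw [← Complex.ofReal_mul, Real.mul_self_sqrt Real.pi_pos.le]
  rw [parabolicCylinderD_zero, parabolicCylinderD_zero, pcfEven, pcfEven]
  calc _ = ((2 : ℂ) ^ (a / 2) * 2 ^ (-a / 2)) * ((√Real.pi : ℂ) * (√Real.pi : ℂ)) *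
        (Complex.Gamma ((1 - a) / 2) * Complex.Gamma ((1 - -a) / 2))⁻¹ := by
        rw [mul_inv]; ring
    _ = _ := by
        rw [h1, h2, h3, inv_div, one_mul]
        field_simp

/-! ### Weber's equation along a line and the Wronskian -/

theorem hasDerivAt_parabolicCylinderD_affine {δ : ℂ} (hδ : δ ≠ 0) (a c t : ℂ) :
    HasDerivAt (fun t => parabolicCylinderD a (δ * t + c / δ))
      ((δ ^ 2 * t + c) / 2 * parabolicCylinderD a (δ * t + c / δ) -
        δ * parabolicCylinderD (a + 1) (δ * t + c / δ)) t := by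
  have h := (hasDerivAt_parabolicCylinderD_up a (δ * t + c / δ)).comp t
    (((hasDerivAt_id t).const_mul δ).add_const (c / δ))
  convert! h using 1
  field_simp

/-- With the preceding lemma, Weber's equation along a line as a first order system. -/
theorem hasDerivAt_mul_parabolicCylinderD_affine {δ : ℂ} (hδ : δ ≠ 0) (a c t : ℂ) :
    HasDerivAt (fun t => δ * parabolicCylinderD (a + 1) (δ * t + c / δ))
      (-((δ ^ 2 * t + c) / 2) * (δ * parabolicCylinderD (a + 1) (δ * t + c / δ)) +
        δ ^ 2 * (a + 1) * parabolicCylinderD a (δ * t + c / δ)) t := by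
  have h := ((hasDerivAt_parabolicCylinderD_down a (δ * t + c / δ)).comp t
    (((hasDerivAt_id t).const_mul δ).add_const (c / δ))).const_mul δ
  convert! h using 1
  field_simp

/-- The Wronskian of `t ↦ D_a(δ t + c / δ)` and `t ↦ D_{-a-1}(δ' t - c / δ')`, for `δ'² = -δ²`, does
not vanish. It is constant, and at `t = -c / δ²`, where both arguments are `0`, it equals
`δ' cos (π a / 2) + δ sin (π a / 2)`. -/
theorem parabolicCylinderD_wronskian_ne_zero {δ δ' : ℂ} (hδ : δ ≠ 0) (hδ' : δ' ^ 2 = -δ ^ 2)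
    {a b : ℂ} (hab : b = -a - 1) (c : ℂ) :
    parabolicCylinderD a (c / δ) * parabolicCylinderD b (-c / δ') * c +
      (δ' * parabolicCylinderD a (c / δ) * parabolicCylinderD (b + 1) (-c / δ') -
        δ * parabolicCylinderD b (-c / δ') * parabolicCylinderD (a + 1) (c / δ)) ≠ 0 := by
  have hδ'0 : δ' ≠ 0 := by
    rintro rfl
    apply hδ
    simpa using hδ'
  set f : ℂ → ℂ := fun t => parabolicCylinderD a (δ * t + c / δ) with hf
  set g : ℂ → ℂ := fun t => δ * parabolicCylinderD (a + 1) (δ * t + c / δ) with hg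
  set f' : ℂ → ℂ := fun t => parabolicCylinderD b (δ' * t + -c / δ') with hf'
  set g' : ℂ → ℂ := fun t => δ' * parabolicCylinderD (b + 1) (δ' * t + -c / δ') with hg'
  set W : ℂ → ℂ := fun t => f t * ((δ ^ 2 * t + c) * f' t + g' t) - g t * f' t with hW
  have hder : ∀ t, HasDerivAt W 0 t := fun t => by
    have h1 : HasDerivAt f _ t := hasDerivAt_parabolicCylinderD_affine hδ a c t
    have h2 : HasDerivAt g _ t := hasDerivAt_mul_parabolicCylinderD_affine hδ a c t
    have h3 : HasDerivAt f' _ t := hasDerivAt_parabolicCylinderD_affine hδ'0 b (-c) t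
    have h4 : HasDerivAt g' _ t := hasDerivAt_mul_parabolicCylinderD_affine hδ'0 b (-c) t
    have hl : HasDerivAt (fun t => δ ^ 2 * t + c) (δ ^ 2 * 1) t :=
      ((hasDerivAt_id t).const_mul (δ ^ 2)).add_const c
    have h : HasDerivAt W _ t := (h1.mul ((hl.mul h3).add h4)).sub (h2.mul h3)
    convert! h using 1
    simp only [Pi.add_apply, Pi.mul_apply, hf, hg, hf', hg', hδ', hab]
    ring
  have hconst : W 0 = W (-c / δ ^ 2) := is_const_of_deriv_eq_zero
    (fun t => (hder t).differentiableAt) (fun t => (hder t).deriv) _ _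
  have e1 : δ * (-c / δ ^ 2) + c / δ = 0 := by field_simp; ring
  have e2 : δ' * (-c / δ ^ 2) + -c / δ' = 0 := by
    rw [show δ ^ 2 = -δ' ^ 2 by rw [hδ', neg_neg]]
    field_simp
    ring
  have e3 : δ ^ 2 * (-c / δ ^ 2) + c = 0 := by field_simp; ring
  have hc1 := parabolicCylinderD_zero_mul_neg a
  have hc2 := parabolicCylinderD_zero_mul_neg (a + 1)
  rw [show Real.pi * (a + 1) / 2 = Real.pi * a / 2 + Real.pi / 2 by ring,
    Complex.cos_add_pi_div_two] at hc2
  have hval : W (-c / δ ^ 2) =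
      δ' * Complex.cos (Real.pi * a / 2) + δ * Complex.sin (Real.pi * a / 2) := by
    simp only [hW, hf, hg, hf', hg', e1, e2, e3]
    rw [show b = -(a + 1) by rw [hab]; ring, show -(a + 1) + 1 = -a by ring]
    linear_combination δ' * hc1 - δ * hc2
  have hW0 : W (-c / δ ^ 2) ≠ 0 := by
    rw [hval]
    intro h0
    have hsq : δ' ^ 2 * Complex.cos (Real.pi * a / 2) ^ 2 =
        δ ^ 2 * Complex.sin (Real.pi * a / 2) ^ 2 := by
      linear_combination (δ' * Complex.cos (Real.pi * a / 2) -
        δ * Complex.sin (Real.pi * a / 2)) * h0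
    apply pow_ne_zero 2 hδ
    have h1 := Complex.sin_sq_add_cos_sq (Real.pi * a / 2)
    linear_combination -δ ^ 2 * h1 - hsq + hδ' * Complex.cos (Real.pi * a / 2) ^ 2
  rw [← hconst] at hW0
  convert! hW0 using 1
  simp only [hW, hf, hg, hf', hg', mul_zero, zero_add]
  ring

/-! ### The generating function -/

/-- If near `0` the functions `fw`, `fy`, `fA`, `fB` evolve by the insertion derivation and
`Z' = Z fw`, then the peak sums at their initial values are the Taylor coefficients of `Z`. -/
theorem hasSum_peakSum {Z fA fB fy fw : ℂ → ℂ} {r : ℝ}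
    (hZ : ∀ t ∈ Metric.ball (0 : ℂ) r, HasDerivAt Z (Z t * fw t) t)
    (hw : ∀ t ∈ Metric.ball (0 : ℂ) r, HasDerivAt fw (fA t) t)
    (hy : ∀ t ∈ Metric.ball (0 : ℂ) r, HasDerivAt fy (fB t) t)
    (hA : ∀ t ∈ Metric.ball (0 : ℂ) r, HasDerivAt fA (fA t * fy t + fB t * fw t) t)
    (hB : ∀ t ∈ Metric.ball (0 : ℂ) r, HasDerivAt fB (fA t * fy t + fB t * fw t) t)
    {t : ℂ} (ht : t ∈ Metric.ball (0 : ℂ) r) :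
    HasSum (fun n : ℕ => Z 0 * peakSum n (fA 0) (fB 0) (fy 0) (fw 0) *
      (t ^ n / (n.factorial : ℂ))) (Z t) := by
  have hiter : ∀ n : ℕ, ∀ t ∈ Metric.ball (0 : ℂ) r,
      iteratedDeriv n Z t = Z t * peakSum n (fA t) (fB t) (fy t) (fw t) := by
    intro n
    induction n with
    | zero =>
      intro t _
      simp [peakSum, descWord, List.permutations', peakWeight]
    | succ n ih =>
      intro t ht
      have hev : iteratedDeriv n Z =ᶠ[nhds t]
          fun t => Z t * peakSum n (fA t) (fB t) (fy t) (fw t) :=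
        Filter.eventually_of_mem (Metric.isOpen_ball.mem_nhds ht) ih
      rw [iteratedDeriv_succ, hev.deriv_eq]
      refine HasDerivAt.deriv ?_
      convert! (hZ t ht).mul
        (hasDerivAt_peakSum (hw t ht) (hy t ht) (hA t ht) (hB t ht) n) using 1
      ring
  have hdiff : DifferentiableOn ℂ Z (Metric.ball 0 r) :=
    fun t ht => (hZ t ht).differentiableAt.differentiableWithinAt
  have hr : (0 : ℂ) ∈ Metric.ball (0 : ℂ) r :=
    Metric.mem_ball_self (Metric.pos_of_mem_ball ht)
  convert! Complex.hasSum_taylorSeries_on_ball hdiff ht using 2 with n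
  rw [hiter n 0 hr, smul_eq_mul, smul_eq_mul, sub_zero, div_eq_mul_inv]
  ring

theorem mainTheorem1 (x y z w u v : ℂ) (hne : x * v ≠ z * u)
    (δ δ' : ℂ) (hδ : δ ^ 2 = x * v - z * u) (hδ' : δ' ^ 2 = z * u - x * v)
    (p q r s : ℂ)
    (hp : p = parabolicCylinderD ((z * u - y * w) / δ ^ 2) ((w - y) / δ))
    (hq : q = parabolicCylinderD ((x * v - y * w) / δ' ^ 2) ((y - w) / δ'))
    (hr : r = parabolicCylinderD ((x * v - y * w) / δ ^ 2) ((w - y) / δ))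
    (hs : s = parabolicCylinderD ((z * u - y * w) / δ' ^ 2) ((y - w) / δ'))
    (den : ℂ → ℂ)
    (hden : ∀ t : ℂ, den t =
      (δ' * s - q * y) *
          parabolicCylinderD ((z * u - y * w) / δ ^ 2) (δ * t + (w - y) / δ) +
        (p * w - δ * r) *
          parabolicCylinderD ((x * v - y * w) / δ' ^ 2) (δ' * t + (y - w) / δ')) :
    ∀ᶠ t : ℂ in nhds 0,
      den t ≠ 0 ∧
      HasSum (fun n : ℕ => peakPoly n x y z w u v * (t ^ n / (n.factorial : ℂ)))
        (z * (p * q * (w - y) + (δ' * p * s - δ * q * r)) *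
            Complex.exp ((w - y) / 2 * t + δ ^ 2 / 4 * t ^ 2) / den t) := by
  have hδ2 : δ ^ 2 ≠ 0 := by rw [hδ]; exact sub_ne_zero.2 hne
  have hδ0 : δ ≠ 0 := fun h => hδ2 (by rw [h]; ring)
  have hδδ' : δ' ^ 2 = -δ ^ 2 := by rw [hδ, hδ']; ring
  have hδ'2 : δ' ^ 2 ≠ 0 := by rw [hδδ']; exact neg_ne_zero.2 hδ2
  have hδ'0 : δ' ≠ 0 := fun h => hδ'2 (by rw [h]; ring)
  set c : ℂ := w - y with hc
  have hyw : y - w = -c := by rw [hc]; ring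
  rw [hyw] at hq hs
  simp only [hyw] at hden
  -- All four functions have an index `a`, `a + 1`, `b` or `b + 1`, where `b = -a - 1`.
  set a : ℂ := (z * u - y * w) / δ ^ 2 with ha
  set b : ℂ := (x * v - y * w) / δ' ^ 2 with hb
  have haδ : δ ^ 2 * a = z * u - y * w := by rw [ha]; field_simp
  have haδ1 : δ ^ 2 * (a + 1) = x * v - y * w := by linear_combination haδ + hδ
  have hbδ1 : δ' ^ 2 * (b + 1) = z * u - y * w := by
    have : δ' ^ 2 * b = x * v - y * w := by rw [hb]; field_simp
    linear_combination this + hδ'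
  have ha1 : (x * v - y * w) / δ ^ 2 = a + 1 := by rw [← haδ1]; field_simp
  have hb1 : (z * u - y * w) / δ' ^ 2 = b + 1 := by rw [← hbδ1]; field_simp
  have hab : b = -a - 1 := by
    rw [hb, hδδ', ← haδ1]
    field_simp
    ring
  rw [ha1] at hr
  rw [hb1] at hs
  set N : ℂ := p * q * c + (δ' * p * s - δ * q * r) with hN
  have hN0 : N ≠ 0 := by
    rw [hN, hp, hq, hr, hs]
    exact parabolicCylinderD_wronskian_ne_zero hδ0 hδδ' hab c
  -- `den' = θ den - U` and `U' = (x v - y w) den - θ U`, so that `U / den` solves the Riccati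
  -- equation of the letter `w`.
  set θ : ℂ → ℂ := fun t => (δ ^ 2 * t + c) / 2 with hθ
  set U : ℂ → ℂ := fun t =>
    (δ' * s - q * y) * (δ * parabolicCylinderD (a + 1) (δ * t + c / δ)) +
      (p * w - δ * r) * ((δ ^ 2 * t + c) * parabolicCylinderD b (δ' * t + -c / δ') +
        δ' * parabolicCylinderD (b + 1) (δ' * t + -c / δ')) with hU
  have hθd : ∀ t, HasDerivAt θ (δ ^ 2 / 2) t := fun t => by
    convert! (((hasDerivAt_id t).const_mul (δ ^ 2)).add_const c).div_const 2 using 1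
    ring
  have hdend : ∀ t, HasDerivAt den (θ t * den t - U t) t := fun t => by
    have h1 := hasDerivAt_parabolicCylinderD_affine hδ0 a c t
    have h3 := hasDerivAt_parabolicCylinderD_affine hδ'0 b (-c) t
    rw [funext hden]
    convert! (h1.const_mul (δ' * s - q * y)).add (h3.const_mul (p * w - δ * r)) using 1
    simp only [hU, hθ, hδδ']
    ring
  have hUd : ∀ t, HasDerivAt U ((x * v - y * w) * den t - θ t * U t) t := fun t => by
    have h2 := hasDerivAt_mul_parabolicCylinderD_affine hδ0 a c t
    have h3 := hasDerivAt_parabolicCylinderD_affine hδ'0 b (-c) t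
    have h4 := hasDerivAt_mul_parabolicCylinderD_affine hδ'0 b (-c) t
    have hl : HasDerivAt (fun t => δ ^ 2 * t + c) (δ ^ 2 * 1) t :=
      ((hasDerivAt_id t).const_mul (δ ^ 2)).add_const c
    convert! (h2.const_mul (δ' * s - q * y)).add
      (((hl.mul h3).add h4).const_mul (p * w - δ * r)) using 1
    simp only [hU, hθ, hden, haδ1, hbδ1]
    rw [hδδ', show z * u = x * v - δ ^ 2 by rw [hδ]; ring]
    ring
  have hden0 : den 0 = N := by
    rw [hden]
    simp only [mul_zero, zero_add, ← hp, ← hq]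
    rw [hN, hc]
    ring
  have hU0 : U 0 = w * N := by
    simp only [hU, mul_zero, zero_add, ← hq, ← hr, ← hs]
    rw [hN, hc]
    ring
  have hcont : ContinuousAt den 0 := (hdend 0).continuousAt
  obtain ⟨ε, hε, hball⟩ := Metric.eventually_nhds_iff_ball.1
    (hcont.eventually_ne (by rw [hden0]; exact hN0))
  refine Metric.eventually_nhds_iff_ball.2 ⟨ε, hε, fun t ht => ⟨hball t ht, ?_⟩⟩
  -- The solution of the differential system with initial values `z, w, y, x v, z u`; the letters
  -- `y` and `B` are recovered from `W - Y = 2 θ` and `A - B = δ²`.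
  set fw : ℂ → ℂ := fun t => U t / den t with hfw
  set fA : ℂ → ℂ := fun t => x * v - y * w - 2 * (θ t * fw t) + fw t ^ 2 with hfA
  set Z : ℂ → ℂ := fun t => z * N * Complex.exp (c / 2 * t + δ ^ 2 / 4 * t ^ 2) / den t with hZ
  have hw' : ∀ t ∈ Metric.ball (0 : ℂ) ε, HasDerivAt fw (fA t) t := fun t ht => by
    have h0 := hball t ht
    convert! (hUd t).div (hdend t) h0 using 1
    simp only [hfA, hfw]
    field_simp
    ring
  have hA' : ∀ t ∈ Metric.ball (0 : ℂ) ε, HasDerivAt fA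
      (fA t * (fw t - 2 * θ t) + (fA t - δ ^ 2) * fw t) t := fun t ht => by
    convert! ((((hθd t).mul (hw' t ht)).const_mul 2).const_sub (x * v - y * w)).add
      ((hw' t ht).pow 2) using 1
    push_cast
    ring
  have key := hasSum_peakSum (Z := Z) (fA := fA) (fB := fun t => fA t - δ ^ 2)
    (fy := fun t => fw t - 2 * θ t) (fw := fw) (r := ε) ?_ hw' ?_ hA' ?_ ht
  · have hw0 : fw 0 = w := by simp only [hfw]; rw [hU0, hden0]; field_simp
    have hθ0 : θ 0 = c / 2 := by simp [hθ]
    have hA0 : fA 0 = x * v := by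
      simp only [hfA]
      rw [hw0, hθ0, hc]
      ring
    have hB0 : fA 0 - δ ^ 2 = z * u := by rw [hA0, hδ]; ring
    have hy0 : fw 0 - 2 * θ 0 = y := by rw [hw0, hθ0, hc]; ring
    have hZ0 : Z 0 = z := by
      simp only [hZ]
      rw [hden0]
      simp [hN0]
    rw [hZ0, hB0, hy0, hA0, hw0] at key
    simpa only [peakPoly_eq_peakSum] using key
  · intro t ht
    have h0 := hball t ht
    have hE : HasDerivAt (fun t => c / 2 * t + δ ^ 2 / 4 * t ^ 2) (θ t) t := by
      convert! ((hasDerivAt_id t).const_mul (c / 2)).add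
        ((hasDerivAt_pow 2 t).const_mul (δ ^ 2 / 4)) using 1
      simp only [hθ]
      push_cast
      ring
    convert! (hE.cexp.const_mul (z * N)).div (hdend t) h0 using 1
    simp only [hZ, hfw]
    field_simp
    ring
  · intro t ht
    convert! (hw' t ht).sub ((hθd t).const_mul 2) using 1
    ring
  · intro t ht
    exact (hA' t ht).sub_const _
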